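/- Let $X$ be a finite non-empty set and let $r\colon X\times X\to X\times X$, $r(x,y)=(\sigma_x(y),\tau_y(x))$, be a non-degenerate solution of the Yang--Baxter equation; that is, $r$ is bijective, $r_1r_2r_1=r_2r_1r_2$ on $X\times X\times X$, where $r_1=r\times\mathrm{id}$ and $r_2=\mathrm{id}\times r$, and all the maps $\sigma_x,\tau_x\colon X\to X$ are bijective. Let \[G(X,r)=\langle X\mid xy=\sigma_x(y)\tau_y(x)\ \text{for all } x,y\in X\rangle\] be its structure group, let $\iota\colon X\to G(X,r)$ be the canonical map, and let $(\tilde X,\tilde r)$ be the injectivization of $(X,r)$: $\tilde X=\iota(X)$ and $\tilde r\colon\tilde X\times\tilde X\to\tilde X\times\tilde X$ is the (unique, well-defined) map such that $\tilde r(\iota(x),\iota(y))=(\iota(\sigma_x(y)),\iota(\tau_y(x)))$ for all $x,y\in X$. (Equivalently, $\tilde r$ is the restriction to $\tilde X\times\tilde X$ of the solution $r_{G(X,r)}$ associated with the natural skew left brace structure on $G(X,r)$.) Then the group $G(X,r)$ is torsion-free (its only element of finite order is the identity) if and only if $\tilde r^{\,2}=\mathrm{id}$, that is, the injectivization of $(X,r)$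 is involutive. -/

import Mathlib

namespace YBE

universe u

variable {X : Type u}

/-- First component of `r (x, y) = (σ_x(y), τ_y(x))`. -/
def sigma (r : X × X → X × X) (x y : X) : X := (r (x, y)).1

/-- Second component of `r (x, y) = (σ_x(y), τ_y(x))`; the index is the first argument. -/
def tau (r : X × X → X × X) (y x : X) : X := (r (x, y)).2

/-- `r × id` on `X × X × X`. -/
def r₁ (r : X × X → X × X) (p : X × X × X) : X × X × X :=
  ((r (p.1, p.2.1)).1, (r (p.1, p.2.1)).2, p.2.2)

/-- `id × r` on `X × X × X`. -/
def r₂ (r : X × X → X × X) (p : X × X × X) : X × X × X :=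
  (p.1, r p.2)

/-- `(X, r)` is a (set-theoretic) solution of the Yang-Baxter equation: `X` is non-empty, `r` is
bijective and the braid relation holds. -/
structure IsSolution (r : X × X → X × X) : Prop where
  nonempty : Nonempty X
  bijective : Function.Bijective r
  braid : r₁ r ∘ r₂ r ∘ r₁ r = r₂ r ∘ r₁ r ∘ r₂ r

/-- All the maps `σ_x` and `τ_x` are bijective. -/
structure IsNonDegenerate (r : X × X → X × X) : Prop where
  sigma_bijective : ∀ x, Function.Bijective (sigma r x)
  tau_bijective : ∀ x, Function.Bijective (tau r x)

/-- `r² = id`. -/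
def IsInvolutive (r : X × X → X × X) : Prop := r ∘ r = id

/-- The relators `x y (σ_x(y) τ_y(x))⁻¹` of the structure group. -/
def structureRels (r : X × X → X × X) : Set (FreeGroup X) :=
  {w | ∃ x y : X, w = FreeGroup.of x * FreeGroup.of y *
    (FreeGroup.of (sigma r x y) * FreeGroup.of (tau r y x))⁻¹}

/-- The structure group `G(X, r) = ⟨X | x y = σ_x(y) τ_y(x)⟩`. -/
abbrev StructureGroup (r : X × X → X × X) : Type u := PresentedGroup (structureRels r)

/-- The canonical map `ι : X → G(X, r)`. -/
def iota (r : X × X → X × X) (x : X) : StructureGroup r := PresentedGroup.of x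

/-- No element other than `1` has finite order. (Mathlib's `IsMulTorsionFree` asks for unique roots,
which is strictly stronger for non-commutative groups.) -/
def IsTorsionFreeGroup (G : Type*) [Group G] : Prop := ∀ g : G, IsOfFinOrder g → g = 1

/-- `X̃ = ι(X)`. -/
abbrev Tilde (r : X × X → X × X) : Type u := Set.range (iota r)

/-- The map `ι`, with codomain `X̃ = ι(X)`. -/
def toTilde (r : X × X → X × X) (x : X) : Tilde r := ⟨iota r x, x, rfl⟩

theorem toTilde_surjective (r : X × X → X × X) : Function.Surjective (toTilde r) := by
  rintro ⟨_, x, rfl⟩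
  exact ⟨x, rfl⟩

theorem iota_mul_iota (r : X × X → X × X) (x y : X) :
    iota r x * iota r y = iota r (sigma r x y) * iota r (tau r y x) := by
  have h : PresentedGroup.mk (structureRels r) (FreeGroup.of x * FreeGroup.of y *
      (FreeGroup.of (sigma r x y) * FreeGroup.of (tau r y x))⁻¹) = 1 :=
    PresentedGroup.one_of_mem ⟨x, y, rfl⟩
  rw [map_mul, map_inv, mul_inv_eq_one, map_mul, map_mul] at h
  exact h

theorem eq_of_iota_eq {H : Type*} [Group H] {r : X × X → X × X} (f : X → H)
    (hf : ∀ x y, f x * f y = f (sigma r x y) * f (tau r y x)) {x x' : X}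
    (h : iota r x = iota r x') : f x = f x' := by
  have hrel : ∀ w ∈ structureRels r, FreeGroup.lift f w = 1 := by
    rintro w ⟨a, b, rfl⟩
    simp only [map_mul, map_inv, FreeGroup.lift_apply_of]
    rw [mul_inv_eq_one]
    exact hf a b
  have := congrArg (PresentedGroup.toGroup hrel) h
  simpa [iota] using this

theorem sigma_eq_of_iota_eq {r : X × X → X × X} (hr : IsSolution r) (hnd : IsNonDegenerate r)
    {x x' : X} (h : iota r x = iota r x') : sigma r x = sigma r x' := by
  have key := eq_of_iota_eq (r := r) (H := Equiv.Perm X)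
    (fun x => Equiv.ofBijective (sigma r x) (hnd.sigma_bijective x)) (by
      intro a b
      ext z
      exact (congrArg Prod.fst (congrFun hr.braid (a, b, z))).symm) h
  exact congrArg (fun e : Equiv.Perm X => (e : X → X)) key

theorem tau_eq_of_iota_eq {r : X × X → X × X} (hr : IsSolution r) (hnd : IsNonDegenerate r)
    {x x' : X} (h : iota r x = iota r x') : tau r x = tau r x' := by
  have key := eq_of_iota_eq (r := r) (H := (Equiv.Perm X)ᵐᵒᵖ)
    (fun x => MulOpposite.op (Equiv.ofBijective (tau r x) (hnd.tau_bijective x))) (by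
      intro a b
      rw [← MulOpposite.op_mul, ← MulOpposite.op_mul]
      congr 1
      ext z
      exact congrArg (fun p => p.2.2) (congrFun hr.braid (z, a, b))) h
  exact congrArg (fun e : (Equiv.Perm X)ᵐᵒᵖ => (e.unop : X → X)) key

theorem iota_congr {r : X × X → X × X} (hr : IsSolution r) (hnd : IsNonDegenerate r)
    {x x' y y' : X} (hx : iota r x = iota r x') (hy : iota r y = iota r y') :
    iota r (sigma r x y) = iota r (sigma r x' y') ∧
      iota r (tau r y x) = iota r (tau r y' x') := by
  have h1 := iota_mul_iota r x y
  have h2 := iota_mul_iota r x y'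
  have h3 := iota_mul_iota r x' y'
  rw [← tau_eq_of_iota_eq hr hnd hy, ← hy, h1] at h2
  have h4 := mul_right_cancel h2
  rw [← sigma_eq_of_iota_eq hr hnd hx, ← hx, ← hy, h1, h4] at h3
  have h5 := mul_left_cancel h3
  rw [← sigma_eq_of_iota_eq hr hnd hx]
  exact ⟨h4, h5⟩

/-- The map `r` descends along `ι` in exactly one way. -/
theorem existsUnique_injectivization {r : X × X → X × X} (hr : IsSolution r)
    (hnd : IsNonDegenerate r) :
    ∃! s : Tilde r × Tilde r → Tilde r × Tilde r,
      ∀ x y : X, s (toTilde r x, toTilde r y) = Prod.map (toTilde r) (toTilde r) (r (x, y)) := by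
  choose g hg using toTilde_surjective r
  refine ⟨fun p => Prod.map (toTilde r) (toTilde r) (r (g p.1, g p.2)), ?_, ?_⟩
  · intro x y
    have h := iota_congr hr hnd (congrArg Subtype.val (hg (toTilde r x)))
      (congrArg Subtype.val (hg (toTilde r y)))
    exact Prod.ext (Subtype.ext h.1) (Subtype.ext h.2)
  · intro s hs
    funext p
    rw [← hs, hg, hg]

/-- The injectivization `(X̃, r̃)` of `(X, r)`: `X̃ = ι(X)` and `r̃` is the map with
`r̃ (ι × ι) = (ι × ι) r`. It is the restriction to `X̃` of the solution associated with the skew left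
brace `G(X, r)`, see `injectivization_eq_restrict`. -/
noncomputable def injectivization (r : X × X → X × X) (hr : IsSolution r)
    (hnd : IsNonDegenerate r) : Tilde r × Tilde r → Tilde r × Tilde r :=
  (existsUnique_injectivization hr hnd).choose

theorem injectivization_toTilde {r : X × X → X × X} (hr : IsSolution r)
    (hnd : IsNonDegenerate r) (x y : X) :
    injectivization r hr hnd (toTilde r x, toTilde r y) =
      Prod.map (toTilde r) (toTilde r) (r (x, y)) :=
  (existsUnique_injectivization hr hnd).choose_spec.1 x y

/-- A skew left brace; the operation `∘` is written multiplicatively. Neither group has to be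
commutative. -/
class SkewLeftBrace (A : Type*) [AddGroup A] [Group A] : Prop where
  mul_add_eq : ∀ a b c : A, a * (b + c) = a * b + -a + a * c

/-- `r_A(a, b) = (λ_a(b), λ_a(b)' ∘ a ∘ b)` with `λ_a(b) = -a + a ∘ b`. -/
def braceMap (A : Type*) [AddGroup A] [Group A] (p : A × A) : A × A :=
  (-p.1 + p.1 * p.2, (-p.1 + p.1 * p.2)⁻¹ * p.1 * p.2)

/-- For a skew left brace structure on the group `G(X, r)` with `r_G (ι × ι) = (ι × ι) r`, the
injectivization is the restriction of `r_G` to `X̃ = ι(X)`. -/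
theorem injectivization_eq_restrict {r : X × X → X × X} (hr : IsSolution r)
    (hnd : IsNonDegenerate r) [AddGroup (StructureGroup r)] [SkewLeftBrace (StructureGroup r)]
    (hG : braceMap (StructureGroup r) ∘ Prod.map (iota r) (iota r) =
      Prod.map (iota r) (iota r) ∘ r) (p : Tilde r × Tilde r) :
    Prod.map Subtype.val Subtype.val (injectivization r hr hnd p) =
      braceMap (StructureGroup r) (p.1, p.2) := by
  obtain ⟨a, b⟩ := p
  obtain ⟨x, rfl⟩ := toTilde_surjective r a
  obtain ⟨y, rfl⟩ := toTilde_surjective r b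
  rw [injectivization_toTilde]
  exact (congrFun hG (x, y)).symm

/-- The injectivization of a finite non-degenerate solution is a solution. -/
theorem injectivization_isSolution [Finite X] {r : X × X → X × X} (hr : IsSolution r)
    (hnd : IsNonDegenerate r) : IsSolution (injectivization r hr hnd) where
  nonempty := hr.nonempty.map (toTilde r)
  bijective := by
    have : Finite (Tilde r) := Finite.of_surjective _ (toTilde_surjective r)
    refine Function.Surjective.bijective_of_finite ?_
    rintro ⟨a, b⟩
    obtain ⟨x, rfl⟩ := toTilde_surjective r a
    obtain ⟨y, rfl⟩ := toTilde_surjective r b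
    obtain ⟨⟨u, v⟩, huv⟩ := hr.bijective.2 (x, y)
    refine ⟨(toTilde r u, toTilde r v), ?_⟩
    rw [injectivization_toTilde, huv]
    rfl
  braid := by
    funext ⟨a, b, c⟩
    obtain ⟨x, rfl⟩ := toTilde_surjective r a
    obtain ⟨y, rfl⟩ := toTilde_surjective r b
    obtain ⟨z, rfl⟩ := toTilde_surjective r c
    have h := congrArg (Prod.map (toTilde r) (Prod.map (toTilde r) (toTilde r)))
      (congrFun hr.braid (x, y, z))
    simpa [r₁, r₂, injectivization_toTilde, Prod.map] using h

end YBE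

/-!
Let `Y = ι(X)` be the injectivization, `G` the structure group and `λ : G → Perm Y` the action
extending `σ`. Both implications are read off from the permutations `S_y : g ↦ g ∘ λ_g⁻¹(y)` of
`G` (`addGen`), which are the maps `g ↦ g + y` of the skew left brace structure of `G`. No skew
brace has to be constructed: it is enough that the `S_y` satisfy the rack relation
`S_z S_y = S_{y ◁ z} S_z`, where `y ◁ z` is the first component of `r²(y, λ_y⁻¹(z))`
(`addGen_mul_addGen`), and that left multiplication by `g` conjugates `S_y` to `S_{λ_g(y)}`
(`mulLeft_conj_addGen`).

*Torsion-free implies involutive.* The group `P` generated by the `S_y` permutes its finite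
generating set by conjugation. A commutator in `P` depends only on the permutations induced by its
two entries, so there are finitely many commutators and, by Schur's theorem, `[P, P]` is finite
(`Subgroup.finite_commutator_closure`). Left multiplications normalize `[P, P]`, and this makes the
`[P, P]`-orbit of `1 ∈ G` a finite subgroup of `G`. If `G` is torsion-free, this subgroup is
trivial, so `S_z S_y 1 = S_y S_z 1` for all `y, z`, which says that `r² = id` on `Y`.

*Involutive implies torsion-free.* The group `G` acts on `ℤ^Y` by `x · v = e_x + σ_x(v)` for
`x ∈ Y`. As `y ◁ z = y`, the `S_y` commute, so they define an action of `ℤ^Y` on `G`, and the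
orbit map of `1 ∈ G` under this action is inverse to the orbit map of `0 ∈ ℤ^Y` under `G`. Hence `G`
acts simply transitively on `ℤ^Y`. Since it acts by translations and permutations of coordinates, it
preserves the pointwise order, so an element of finite order fixes the supremum of any of its orbits
(`OrderIso.exists_apply_eq_self_of_isOfFinOrder`) and is therefore trivial.
-/

open scoped commutatorElement

/-! ### Fixed points of order isomorphisms, and finiteness of commutator subgroups -/

/-- The supremum of a finite orbit is a fixed point. -/
theorem OrderIso.exists_apply_eq_self_of_isOfFinOrder {α : Type*} [SemilatticeSup α]
    (f : α ≃o α) (hf : IsOfFinOrder f) (a : α) : ∃ v, f v = v := by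
  have : Finite (Subgroup.zpowers f) := finite_zpowers.2 hf
  cases nonempty_fintype (Subgroup.zpowers f)
  set v := Finset.univ.sup' Finset.univ_nonempty
    (fun h : Subgroup.zpowers f => (h : α ≃o α) a) with hv
  have key : ∀ k : Subgroup.zpowers f, (k : α ≃o α) v ≤ v := by
    intro k
    rw [hv, map_finset_sup']
    refine Finset.sup'_le _ _ fun h _ => ?_
    exact Finset.le_sup' (fun h : Subgroup.zpowers f => (h : α ≃o α) a) (Finset.mem_univ (k * h))
  refine ⟨v, le_antisymm (key ⟨f, Subgroup.mem_zpowers f⟩) ?_⟩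
  have h := f.monotone (key ⟨f⁻¹, inv_mem (Subgroup.mem_zpowers f)⟩)
  rwa [show f ((f⁻¹ : α ≃o α) v) = v from f.apply_symm_apply v] at h

/-- A group generated by a finite set which is stable under conjugation has a finite commutator
subgroup. -/
theorem Subgroup.finite_commutator_closure {M : Type*} [Group M] {T : Set M}
    (hT : T.Finite) (hn : T ⊆ Subgroup.normalizer T) :
    Finite (⁅Subgroup.closure T, Subgroup.closure T⁆ : Subgroup M) := by
  set P := Subgroup.closure T
  have hPn : P ≤ Subgroup.normalizer T := (Subgroup.closure_le _).2 hn
  have hconj : ∀ p q : P, (∀ t : T, (p : M) * t * (p : M)⁻¹ = q * t * (q : M)⁻¹) →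
      ∀ x : P, p * x * p⁻¹ = q * x * q⁻¹ := by
    intro p q h x
    have := MonoidHom.eqOn_closure (f := (MulAut.conj (p : M)).toMonoidHom)
      (g := (MulAut.conj (q : M)).toMonoidHom) (s := T) (fun t ht => h ⟨t, ht⟩)
    exact Subtype.ext (this x.2)
  let F : P → T → T := fun p t => ⟨p * t * (p : M)⁻¹, (hPn p.2 t).1 t.2⟩
  have hF : ∀ p q : P, F p = F q → ∀ x : P, p * x * p⁻¹ = q * x * q⁻¹ := fun p q h =>
    hconj p q fun t => congrArg Subtype.val (congrFun h t)
  have : Finite T := hT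
  have hfin : Finite (commutatorSet P) := by
    -- a commutator `⁅p, q⁆` depends only on the permutations `F p` and `F q` of `T`
    choose p q hpq using fun g : commutatorSet P => g.2
    refine Finite.of_injective (fun g => (F (p g), F (q g))) fun g g' h => ?_
    have h1 := hF _ _ (congrArg Prod.fst h)
    have h2 := hF _ _ (congrArg Prod.snd h)
    refine Subtype.ext ?_
    rw [← hpq g, ← hpq g', commutatorElement_def, commutatorElement_def]
    calc p g * q g * (p g)⁻¹ * (q g)⁻¹ = p g * (q g * (p g)⁻¹ * (q g)⁻¹) := by group
      _ = p g * q g' * (p g)⁻¹ * (q g')⁻¹ := by rw [h2]; group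
      _ = p g' * q g' * (p g')⁻¹ * (q g')⁻¹ := by rw [h1]
  rw [← Subgroup.map_subtype_commutator]
  have : Finite (_root_.commutator P) := inferInstance
  exact Set.Finite.image _ (Set.toFinite (_root_.commutator P : Set P))

namespace YBE

/-! ### Brace addition by a generator -/

section Realization

variable {Y G : Type*} [Group G]

/-- The group `G` is generated by a copy `j(Y)` of the solution `(Y, r)`, in which the relations
`x y = σ_x(y) τ_y(x)` hold, and `lam` is an action of `G` on `Y` extending `σ`. -/
structure IsFaithfulRealization (r : Y × Y → Y × Y) (j : Y → G) (lam : G →* Equiv.Perm Y) :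
    Prop where
  injective : Function.Injective j
  closure_range : Subgroup.closure (Set.range j) = ⊤
  lam_apply : ∀ x y, lam (j x) y = sigma r x y
  mul_eq : ∀ x y, j x * j y = j (sigma r x y) * j (tau r y x)

variable {r : Y × Y → Y × Y} {j : Y → G} {lam : G →* Equiv.Perm Y}

/-- The map `g ↦ g + y` of the skew left brace `G`, written with the multiplication and the action
only: `g + y = g ∘ λ_g⁻¹(y)`. -/
def addGenFun (j : Y → G) (lam : G →* Equiv.Perm Y) (y : Y) (g : G) : G :=
  g * j ((lam g)⁻¹ y)

/-- The rack operation `a ◁ b`, first component of `r²(a, λ_a⁻¹(b))`. -/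
def rackOp (r : Y × Y → Y × Y) (j : Y → G) (lam : G →* Equiv.Perm Y) (a b : Y) : Y :=
  (r (r (a, (lam (j a))⁻¹ b))).1

namespace IsFaithfulRealization

theorem sigma_inv_apply (h : IsFaithfulRealization r j lam) (a b : Y) :
    sigma r a ((lam (j a))⁻¹ b) = b := by
  rw [← h.lam_apply]
  exact (lam (j a)).apply_symm_apply b

/-- This injectivity is what makes `g ↦ g + y` invertible: if `k = g ∘ a` with `a = λ_g⁻¹(y)`, then
`λ_a⁻¹(a) = λ_k⁻¹(y)` determines `a`, hence `g`, from `k` and `y`. -/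
theorem lam_inv_self_injective (h : IsFaithfulRealization r j lam) (hnd : IsNonDegenerate r) :
    Function.Injective fun a => (lam (j a))⁻¹ a := by
  -- if `c = λ_a⁻¹(a)` then `a c = a τ_c(a)` in `G`, so `τ_c(a) = c`
  have key : ∀ a, tau r ((lam (j a))⁻¹ a) a = (lam (j a))⁻¹ a := by
    intro a
    have := h.mul_eq a ((lam (j a))⁻¹ a)
    rw [h.sigma_inv_apply] at this
    exact (h.injective (mul_left_cancel this)).symm
  intro a b hab
  have ha := key a
  have hb := key b
  dsimp only at hab
  rw [hab] at ha
  exact (hnd.tau_bijective _).1 (ha.trans hb.symm)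

theorem addGenFun_bijective [Finite Y] (h : IsFaithfulRealization r j lam)
    (hnd : IsNonDegenerate r) (y : Y) : Function.Bijective (addGenFun j lam y) := by
  have hT := Finite.injective_iff_bijective.1 (h.lam_inv_self_injective hnd)
  have hlam : ∀ g, (lam (addGenFun j lam y g))⁻¹ y =
      (lam (j ((lam g)⁻¹ y)))⁻¹ ((lam g)⁻¹ y) := by
    intro g
    rw [addGenFun, map_mul, mul_inv_rev, Equiv.Perm.mul_apply]
  constructor
  · intro g g' hg
    have h1 := hlam g
    rw [hg, hlam g'] at h1
    have h2 := hT.1 h1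
    simp only [addGenFun] at hg
    rw [h2] at hg
    exact mul_right_cancel hg
  · intro k
    obtain ⟨a, ha⟩ := hT.2 ((lam k)⁻¹ y)
    dsimp only at ha
    refine ⟨k * (j a)⁻¹, ?_⟩
    have : (lam (k * (j a)⁻¹))⁻¹ y = a := by
      rw [map_mul, mul_inv_rev, Equiv.Perm.mul_apply, ← ha, map_inv, inv_inv]
      exact (lam (j a)).apply_symm_apply a
    rw [addGenFun, this, inv_mul_cancel_right]

/-- The permutation `g ↦ g + y` of `G`. -/
noncomputable def addGen [Finite Y] (h : IsFaithfulRealization r j lam)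
    (hnd : IsNonDegenerate r) (y : Y) : Equiv.Perm G :=
  Equiv.ofBijective _ (h.addGenFun_bijective hnd y)

theorem addGen_apply [Finite Y] (h : IsFaithfulRealization r j lam)
    (hnd : IsNonDegenerate r) (y : Y) (g : G) :
    h.addGen hnd y g = g * j ((lam g)⁻¹ y) := rfl

theorem addGen_lam_mul [Finite Y] (h : IsFaithfulRealization r j lam)
    (hnd : IsNonDegenerate r) (y : Y) (g : G) :
    h.addGen hnd (lam g y) g = g * j y := by
  rw [addGen_apply]
  congr 2
  exact (lam g).symm_apply_apply y

theorem addGen_addGen_apply [Finite Y] (h : IsFaithfulRealization r j lam)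
    (hnd : IsNonDegenerate r) (y z : Y) (g : G) :
    h.addGen hnd z (h.addGen hnd y g) =
      g * (j ((lam g)⁻¹ y) * j ((lam (j ((lam g)⁻¹ y)))⁻¹ ((lam g)⁻¹ z))) := by
  rw [addGen_apply, addGen_apply, map_mul, mul_inv_rev, Equiv.Perm.mul_apply, mul_assoc]

/-- The action of `G` on `Y` is by rack automorphisms: this is the identity
`r₁² r₂ r₁ = r₂ r₁ r₂²`, a consequence of the braid relation. -/
theorem lam_rackOp (h : IsFaithfulRealization r j lam) (hr : IsSolution r) (g : G) (a b : Y) :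
    lam g (rackOp r j lam a b) = rackOp r j lam (lam g a) (lam g b) := by
  have hg : g ∈ Subgroup.closure (Set.range j) := h.closure_range ▸ Subgroup.mem_top g
  induction hg using Subgroup.closure_induction generalizing a b with
  | mem g hg =>
    obtain ⟨x, rfl⟩ := hg
    have hb := fun p => congrFun hr.braid p
    simp only [Function.comp_apply] at hb
    set c := (lam (j a))⁻¹ b with hc
    have h1 : r₁ r (r₁ r (r₂ r (r₁ r (x, a, c)))) = r₂ r (r₁ r (r₂ r (r₂ r (x, a, c)))) := by
      rw [hb (x, a, c), hb (r₂ r (x, a, c))]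
    have h2 : (r (r (sigma r x a, sigma r (tau r a x) c))).1 = sigma r x (r (r (a, c))).1 :=
      congrArg (fun p => p.1) h1
    have h3 : (lam (j (lam (j x) a)))⁻¹ (lam (j x) b) = sigma r (tau r a x) c := by
      rw [Equiv.Perm.inv_eq_iff_eq, ← h.lam_apply, h.lam_apply x a, ← Equiv.Perm.mul_apply,
        ← map_mul, ← h.mul_eq, map_mul, Equiv.Perm.mul_apply, h.lam_apply a, hc,
        h.sigma_inv_apply]
    rw [rackOp, rackOp, h3, h.lam_apply, h.lam_apply, ← hc, h2]
  | one => simp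
  | mul g k _ _ ihg ihk => simp only [map_mul, Equiv.Perm.mul_apply, ihg, ihk]
  | inv g _ ih =>
    rw [map_inv, Equiv.Perm.inv_eq_iff_eq, ih]
    simp

/-- The rack relation `S_z S_y = S_{y ◁ z} S_z` for the permutations `S_y : g ↦ g + y`. -/
theorem addGen_mul_addGen [Finite Y] (h : IsFaithfulRealization r j lam) (hr : IsSolution r)
    (hnd : IsNonDegenerate r) (y z : Y) :
    h.addGen hnd z * h.addGen hnd y = h.addGen hnd (rackOp r j lam y z) * h.addGen hnd z := by
  ext g
  rw [Equiv.Perm.mul_apply, Equiv.Perm.mul_apply, addGen_addGen_apply, addGen_addGen_apply]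
  rw [← map_inv, h.lam_rackOp hr]
  set a := lam g⁻¹ y
  set b := lam g⁻¹ z
  congr 1
  rw [h.mul_eq, h.sigma_inv_apply]
  congr 2
  rw [eq_comm, Equiv.Perm.inv_eq_iff_eq, h.lam_apply, rackOp]
  have : r (a, (lam (j a))⁻¹ b) = (b, tau r ((lam (j a))⁻¹ b) a) :=
    Prod.ext (h.sigma_inv_apply a b) rfl
  rw [this]
  rfl

/-- In a skew left brace, `k ∘ (k⁻¹ ∘ g + y) = g + λ_k(y)`. -/
theorem mulLeft_conj_addGen [Finite Y] (h : IsFaithfulRealization r j lam)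
    (hnd : IsNonDegenerate r) (k : G) (y : Y) :
    Equiv.mulLeft k * h.addGen hnd y * (Equiv.mulLeft k)⁻¹ = h.addGen hnd (lam k y) := by
  rw [mul_inv_eq_iff_eq_mul]
  ext g
  simp [addGen_apply, mul_assoc]

theorem mem_normalizer_range_addGen [Finite Y] (h : IsFaithfulRealization r j lam)
    (hnd : IsNonDegenerate r) {p : Equiv.Perm G}
    (hp : ∀ y, p * h.addGen hnd y * p⁻¹ ∈ Set.range (h.addGen hnd)) :
    p ∈ Subgroup.normalizer (Set.range (h.addGen hnd)) := by
  rw [Subgroup.mem_normalizer_iff_conj_image_eq]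
  -- an injective map of a finite set into itself is onto
  refine Set.eq_of_subset_of_ncard_le ?_ ?_ (Set.finite_range _)
  · rintro _ ⟨_, ⟨y, rfl⟩, rfl⟩
    exact hp y
  · rw [Set.ncard_image_of_injective _ (MulAut.conj p).injective]

/-! ### Torsion-free groups come from involutive solutions -/

theorem isInvolutive_of_isTorsionFreeGroup [Finite Y] (h : IsFaithfulRealization r j lam)
    (hr : IsSolution r) (hnd : IsNonDegenerate r) (hG : IsTorsionFreeGroup G) :
    IsInvolutive r := by
  set T := Set.range (h.addGen hnd)
  set K := ⁅Subgroup.closure T, Subgroup.closure T⁆ with hK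
  have hfin : Finite K := by
    refine Subgroup.finite_commutator_closure (Set.finite_range (h.addGen hnd)) ?_
    rintro _ ⟨z, rfl⟩
    refine h.mem_normalizer_range_addGen hnd fun y => ⟨rackOp r j lam y z, ?_⟩
    rw [eq_mul_inv_iff_mul_eq, ← h.addGen_mul_addGen hr]
  have hconj : ∀ k : G, ∀ p ∈ K, Equiv.mulLeft k * p * (Equiv.mulLeft k)⁻¹ ∈ K := by
    intro k p hp
    have h1 : Equiv.mulLeft k ∈ Subgroup.normalizer T :=
      h.mem_normalizer_range_addGen hnd fun y => ⟨lam k y, (h.mulLeft_conj_addGen hnd k y).symm⟩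
    have h2 := Subgroup.mem_normalizer_iff_map_conj_eq.1
      (Subgroup.normalizer_le_normalizer_closure T h1)
    have h3 : K.map (MulAut.conj (Equiv.mulLeft k)).toMonoidHom = K := by
      rw [hK, Subgroup.map_commutator]
      exact congrArg₂ _ h2 h2
    rw [← h3]
    exact ⟨p, hp, rfl⟩
  -- `p(1) q(1) = (L q L⁻¹ p)(1)`, where `L` is left multiplication by `p(1)`
  let H : Subgroup G :=
    { carrier := {g | ∃ p ∈ K, p 1 = g}
      one_mem' := ⟨1, one_mem _, rfl⟩
      mul_mem' := by
        rintro _ _ ⟨p, hp, rfl⟩ ⟨q, hq, rfl⟩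
        refine ⟨_, mul_mem (hconj (p 1) q hq) hp, ?_⟩
        rw [Equiv.Perm.mul_apply, Equiv.Perm.mul_apply, Equiv.Perm.mul_apply,
          show (Equiv.mulLeft (p 1))⁻¹ (p 1) = 1 from Equiv.Perm.inv_eq_iff_eq.2 (by simp)]
        simp
      inv_mem' := by
        rintro _ ⟨p, hp, rfl⟩
        refine ⟨_, hconj (p 1)⁻¹ p⁻¹ (inv_mem hp), ?_⟩
        rw [Equiv.Perm.mul_apply, Equiv.Perm.mul_apply,
          show (Equiv.mulLeft (p 1)⁻¹)⁻¹ 1 = p 1 from Equiv.Perm.inv_eq_iff_eq.2 (by simp)]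
        simp }
  have hHfin : Finite H := by
    refine Finite.of_surjective (fun p : K => (⟨p.1 1, p.1, p.2, rfl⟩ : H)) ?_
    rintro ⟨_, p, hp, rfl⟩
    exact ⟨⟨p, hp⟩, rfl⟩
  have hfix : ∀ p ∈ K, p 1 = 1 := by
    intro p hp
    have hmem : p 1 ∈ H := ⟨p, hp, rfl⟩
    exact hG _ (Submonoid.isOfFinOrder_coe.2 (isOfFinOrder_of_finite (⟨p 1, hmem⟩ : H)))
  have hcomm : ∀ y z, h.addGen hnd z (h.addGen hnd y 1) = h.addGen hnd y (h.addGen hnd z 1) := by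
    intro y z
    have hmem : ⁅(h.addGen hnd z)⁻¹, (h.addGen hnd y)⁻¹⁆ ∈ K :=
      Subgroup.commutator_mem_commutator (inv_mem (Subgroup.subset_closure ⟨z, rfl⟩))
        (inv_mem (Subgroup.subset_closure ⟨y, rfl⟩))
    have := hfix _ hmem
    rw [commutatorElement_def, inv_inv, inv_inv, mul_assoc, ← mul_inv_rev,
      Equiv.Perm.mul_apply, Equiv.Perm.inv_eq_iff_eq] at this
    exact this
  -- for `z = σ_y(c)` this reads `y c = z λ_z⁻¹(y)`, whereas `y c = z τ_c(y)`
  funext ⟨y, c⟩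
  have h1 := hcomm y (sigma r y c)
  simp only [addGen_addGen_apply, map_one, inv_one, Equiv.Perm.one_apply, one_mul] at h1
  rw [← h.lam_apply, show (lam (j y))⁻¹ (lam (j y) c) = c from (lam (j y)).symm_apply_apply c,
    h.lam_apply, h.mul_eq] at h1
  have h2 := h.injective (mul_left_cancel h1)
  have h3 : sigma r (sigma r y c) (tau r c y) = y := by rw [h2, h.sigma_inv_apply]
  have h4 := h.mul_eq (sigma r y c) (tau r c y)
  rw [h3, ← h.mul_eq] at h4
  have h5 := h.injective (mul_left_cancel h4)
  exact Prod.ext h3 h5.symm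

end IsFaithfulRealization

/-! ### Involutive solutions have torsion-free groups -/

open scoped Classical in
/-- The affine map `v ↦ e_x + σ_x(v)` of the lattice-ordered group `ℤ^Y`, which is written
multiplicatively. -/
noncomputable def affineGen (s : Equiv.Perm Y) (x : Y) :
    (Y → Multiplicative ℤ) ≃o (Y → Multiplicative ℤ) where
  toFun v := Pi.mulSingle x (Multiplicative.ofAdd 1) * v ∘ ⇑s⁻¹
  invFun v := ((Pi.mulSingle x (Multiplicative.ofAdd 1))⁻¹ * v) ∘ ⇑s
  left_inv v := by ext y; simp
  right_inv v := by ext y; simp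
  map_rel_iff' := by
    intro v w
    simp only [Equiv.coe_fn_mk, mul_le_mul_iff_left]
    constructor
    · intro hvw y
      simpa using hvw (s y)
    · exact fun hvw y => hvw _

open scoped Classical in
theorem affineGen_apply (s : Equiv.Perm Y) (x : Y) (v : Y → Multiplicative ℤ) :
    affineGen s x v = Pi.mulSingle x (Multiplicative.ofAdd 1) * v ∘ ⇑s⁻¹ := rfl

open scoped Classical in
theorem mulSingle_comp_perm_inv (s : Equiv.Perm Y) (x : Y) (n : Multiplicative ℤ) :
    (Pi.mulSingle x n : Y → Multiplicative ℤ) ∘ ⇑s⁻¹ = Pi.mulSingle (s x) n := by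
  ext y
  simp [Pi.mulSingle_apply, Equiv.symm_apply_eq]

namespace IsFaithfulRealization

variable {Φ : G →* (Y → Multiplicative ℤ) ≃o (Y → Multiplicative ℤ)}

/-- The action of `G` on `ℤ^Y` is affine, with linear part given by `lam`. -/
theorem affine_apply (h : IsFaithfulRealization r j lam)
    (hΦ : ∀ x, Φ (j x) = affineGen (lam (j x)) x) (g : G) (v : Y → Multiplicative ℤ) :
    Φ g v = Φ g 1 * v ∘ ⇑(lam g)⁻¹ := by
  have hg : g ∈ Subgroup.closure (Set.range j) := h.closure_range ▸ Subgroup.mem_top g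
  induction hg using Subgroup.closure_induction generalizing v with
  | mem g hg =>
    obtain ⟨x, rfl⟩ := hg
    rw [hΦ, affineGen_apply, affineGen_apply]
    ext
    simp
  | one => simp
  | mul g k _ _ ihg ihk =>
    rw [map_mul, RelIso.mul_apply, RelIso.mul_apply, ihk, ihg, ihg (Φ k 1), map_mul, mul_inv_rev]
    ext
    simp [mul_assoc]
  | inv g _ ih =>
    apply (Φ g).injective
    rw [← RelIso.mul_apply, ← map_mul, mul_inv_cancel, map_one Φ, RelIso.one_apply, ih (_ * _)]
    have h1 := ih (Φ g⁻¹ 1)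
    rw [← RelIso.mul_apply, ← map_mul, mul_inv_cancel, map_one Φ, RelIso.one_apply] at h1
    have h2 : (Φ g⁻¹ 1 * v ∘ ⇑(lam g⁻¹)⁻¹) ∘ ⇑(lam g)⁻¹ = (Φ g⁻¹ 1) ∘ ⇑(lam g)⁻¹ * v := by
      ext
      simp
    rw [h2, ← mul_assoc, ← h1, one_mul]

open scoped Classical in
/-- The orbit map `g ↦ g · 0` carries `g ↦ g ∘ x` to the translation by `e_{λ_g(x)}`. -/
theorem affine_mul_gen (h : IsFaithfulRealization r j lam)
    (hΦ : ∀ x, Φ (j x) = affineGen (lam (j x)) x) (g : G) (x : Y) :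
    Φ (g * j x) 1 = Pi.mulSingle (lam g x) (Multiplicative.ofAdd 1) * Φ g 1 := by
  have h1 : Φ (j x) 1 = Pi.mulSingle x (Multiplicative.ofAdd 1) := by
    rw [hΦ, affineGen_apply]
    ext
    simp
  rw [map_mul, RelIso.mul_apply, h1, h.affine_apply hΦ, mulSingle_comp_perm_inv, mul_comm]

theorem rackOp_eq_of_isInvolutive (hi : IsInvolutive r) (a b : Y) :
    rackOp r j lam a b = a :=
  congrArg Prod.fst (congrFun hi (a, _))

theorem isTorsionFreeGroup_of_isInvolutive [Finite Y] (h : IsFaithfulRealization r j lam)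
    (hr : IsSolution r) (hnd : IsNonDegenerate r) (hi : IsInvolutive r)
    (hΦ : ∀ x, Φ (j x) = affineGen (lam (j x)) x) : IsTorsionFreeGroup G := by
  classical
  cases nonempty_fintype Y
  have hcomm : Pairwise fun y z => ∀ m n : Multiplicative ℤ,
      Commute (zpowersHom _ (h.addGen hnd y) m) (zpowersHom _ (h.addGen hnd z) n) := by
    intro y z _ m n
    have : Commute (h.addGen hnd y) (h.addGen hnd z) := by
      have := h.addGen_mul_addGen hr hnd z y
      rwa [rackOp_eq_of_isInvolutive hi] at this
    exact this.zpow_zpow _ _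
  let Ψ : (Y → Multiplicative ℤ) →* Equiv.Perm G := MonoidHom.noncommPiCoprod _ hcomm
  have hΨ : ∀ y, Ψ (Pi.mulSingle y (Multiplicative.ofAdd 1)) = h.addGen hnd y := by
    intro y
    simp only [Ψ, MonoidHom.noncommPiCoprod_mulSingle]
    simp
  -- the orbit maps `g ↦ Φ g 0` and `v ↦ Ψ v 1` are inverse to each other
  have hleft : ∀ g, Ψ (Φ g 1) 1 = g := by
    intro g
    have hg : g ∈ Subgroup.closure (Set.range j) := h.closure_range ▸ Subgroup.mem_top g
    induction hg using Subgroup.closure_induction_right with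
    | one => simp
    | mul_right g _ y hy ih =>
      obtain ⟨x, rfl⟩ := hy
      rw [h.affine_mul_gen hΦ, map_mul, Equiv.Perm.mul_apply, ih, hΨ, addGen_lam_mul]
    | mul_inv_cancel g _ y hy ih =>
      obtain ⟨x, rfl⟩ := hy
      set k := g * (j x)⁻¹ with hk
      have hgk : g = k * j x := by rw [hk, inv_mul_cancel_right]
      rw [hgk, h.affine_mul_gen hΦ, map_mul, Equiv.Perm.mul_apply, hΨ,
        ← h.addGen_lam_mul hnd] at ih
      exact (h.addGen hnd _).injective ih
  have hright : ∀ v g, Φ (Ψ v g) 1 = v * Φ g 1 := by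
    let D : Subgroup (Y → Multiplicative ℤ) :=
      { carrier := {v | ∀ g, Φ (Ψ v g) 1 = v * Φ g 1}
        one_mem' := by simp
        mul_mem' := by
          intro v w hv hw g
          rw [map_mul, Equiv.Perm.mul_apply, hv, hw, mul_assoc]
        inv_mem' := by
          intro v hv g
          rw [eq_inv_mul_iff_mul_eq, ← hv, ← Equiv.Perm.mul_apply, ← map_mul, mul_inv_cancel,
            map_one Ψ, Equiv.Perm.one_apply] }
    intro v
    suffices hv : v ∈ D from hv
    refine Subgroup.pi_mem_of_mulSingle_mem v fun y => ?_
    have hgen : (Pi.mulSingle y (Multiplicative.ofAdd 1) : Y → Multiplicative ℤ) ∈ D := by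
      intro g
      rw [hΨ, addGen_apply, h.affine_mul_gen hΦ]
      congr 2
      exact (lam g).apply_symm_apply y
    have := zpow_mem hgen (Multiplicative.toAdd (v y))
    rwa [← Pi.mulSingle_zpow, ← ofAdd_zsmul, smul_eq_mul, mul_one, ofAdd_toAdd] at this
  intro g hg
  obtain ⟨v, hv⟩ := OrderIso.exists_apply_eq_self_of_isOfFinOrder (Φ g) (Φ.isOfFinOrder hg) 1
  -- the fixed point lies in the orbit of `0`, on which `G` acts freely
  have h1 : Φ (Ψ v 1) 1 = v := by simp [hright]
  have h2 : Φ (g * Ψ v 1) 1 = Φ (Ψ v 1) 1 := by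
    rw [map_mul, RelIso.mul_apply, h1, hv]
  have h3 := hleft (g * Ψ v 1)
  rw [h2, hleft] at h3
  exact mul_eq_right.1 h3.symm

end IsFaithfulRealization

end Realization

/-! ### The structure group as a realization of the injectivization -/

section Injectivization

universe u

variable {X : Type u} {r : X × X → X × X}

theorem sigma_injectivization (hr : IsSolution r) (hnd : IsNonDegenerate r) (x y : X) :
    sigma (injectivization r hr hnd) (toTilde r x) (toTilde r y) = toTilde r (sigma r x y) := by
  rw [sigma, injectivization_toTilde]
  rfl

theorem tau_injectivization (hr : IsSolution r) (hnd : IsNonDegenerate r) (x y : X) :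
    tau (injectivization r hr hnd) (toTilde r y) (toTilde r x) = toTilde r (tau r y x) := by
  rw [tau, injectivization_toTilde]
  rfl

theorem injectivization_isNonDegenerate [Finite X] (hr : IsSolution r)
    (hnd : IsNonDegenerate r) : IsNonDegenerate (injectivization r hr hnd) := by
  have : Finite (Tilde r) := Finite.of_surjective _ (toTilde_surjective r)
  constructor
  · intro a
    refine Function.Surjective.bijective_of_finite fun b => ?_
    obtain ⟨x, rfl⟩ := toTilde_surjective r a
    obtain ⟨y, rfl⟩ := toTilde_surjective r b
    obtain ⟨z, rfl⟩ := (hnd.sigma_bijective x).2 y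
    exact ⟨toTilde r z, sigma_injectivization hr hnd x z⟩
  · intro a
    refine Function.Surjective.bijective_of_finite fun b => ?_
    obtain ⟨x, rfl⟩ := toTilde_surjective r a
    obtain ⟨y, rfl⟩ := toTilde_surjective r b
    obtain ⟨z, rfl⟩ := (hnd.tau_bijective x).2 y
    exact ⟨toTilde r z, tau_injectivization hr hnd z x⟩

/-- The universal property of the structure group. -/
theorem exists_hom_of_map_mul {H : Type*} [Group H] (f : X → H)
    (hf : ∀ x y, f x * f y = f (sigma r x y) * f (tau r y x)) :
    ∃ F : StructureGroup r →* H, ∀ x, F (iota r x) = f x := by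
  have hrel : ∀ w ∈ structureRels r, FreeGroup.lift f w = 1 := by
    rintro w ⟨a, b, rfl⟩
    simp only [map_mul, map_inv, FreeGroup.lift_apply_of]
    rw [mul_inv_eq_one]
    exact hf a b
  exact ⟨PresentedGroup.toGroup hrel, fun x => PresentedGroup.toGroup.of hrel⟩

/-- The permutation `σ_x` of a non-degenerate solution. -/
noncomputable def IsNonDegenerate.sigmaPerm (hnd : IsNonDegenerate r) (x : X) : Equiv.Perm X :=
  Equiv.ofBijective (sigma r x) (hnd.sigma_bijective x)

theorem IsNonDegenerate.sigmaPerm_mul (hnd : IsNonDegenerate r) (hr : IsSolution r) (x y : X) :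
    hnd.sigmaPerm x * hnd.sigmaPerm y =
      hnd.sigmaPerm (sigma r x y) * hnd.sigmaPerm (tau r y x) := by
  ext z
  exact (congrArg Prod.fst (congrFun hr.braid (x, y, z))).symm

/-- The affine maps `v ↦ e_x + σ_x(v)` satisfy the relations of the structure group, because
`σ_{σ_x(y)}(τ_y(x)) = x` for an involutive solution. -/
theorem affineGen_mul_affineGen (hr : IsSolution r) (hnd : IsNonDegenerate r)
    (hi : IsInvolutive r) (x y : X) :
    affineGen (hnd.sigmaPerm x) x * affineGen (hnd.sigmaPerm y) y =
      affineGen (hnd.sigmaPerm (sigma r x y)) (sigma r x y) *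
        affineGen (hnd.sigmaPerm (tau r y x)) (tau r y x) := by
  classical
  have key : ∀ (s t : Equiv.Perm X) (a b : X) (v : X → Multiplicative ℤ),
      (affineGen s a * affineGen t b) v = Pi.mulSingle a (Multiplicative.ofAdd 1) *
        Pi.mulSingle (s b) (Multiplicative.ofAdd 1) * v ∘ ⇑(s * t)⁻¹ := by
    intro s t a b v
    rw [RelIso.mul_apply, affineGen_apply, affineGen_apply, ← mulSingle_comp_perm_inv]
    ext
    simp [mul_assoc]
  have h1 : hnd.sigmaPerm (sigma r x y) (tau r y x) = x :=
    congrArg Prod.fst (congrFun hi (x, y))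
  have h2 : hnd.sigmaPerm x y = sigma r x y := rfl
  refine DFunLike.ext _ _ fun v => ?_
  rw [key, key, hnd.sigmaPerm_mul hr, h1, h2, mul_comm (Pi.mulSingle x _)]

end Injectivization

end YBE

theorem mainTheorem7 {X : Type*} [Finite X] (r : X × X → X × X)
    (hr : YBE.IsSolution r) (hnd : YBE.IsNonDegenerate r) :
    YBE.IsTorsionFreeGroup (YBE.StructureGroup r) ↔
      YBE.IsInvolutive (YBE.injectivization r hr hnd) := by
  have : Finite (YBE.Tilde r) := Finite.of_surjective _ (YBE.toTilde_surjective r)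
  have hs := YBE.injectivization_isSolution hr hnd
  have hsnd := YBE.injectivization_isNonDegenerate hr hnd
  obtain ⟨lam, hlam⟩ := YBE.exists_hom_of_map_mul (r := r)
    (fun x => hsnd.sigmaPerm (YBE.toTilde r x)) (by
      intro x y
      rw [hsnd.sigmaPerm_mul hs, YBE.sigma_injectivization, YBE.tau_injectivization])
  have h : YBE.IsFaithfulRealization (YBE.injectivization r hr hnd)
      (Subtype.val : YBE.Tilde r → YBE.StructureGroup r) lam := by
    refine ⟨Subtype.val_injective, ?_, ?_, ?_⟩
    · rw [Subtype.range_coe]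
      exact PresentedGroup.closure_range_of _
    · intro a b
      obtain ⟨x, rfl⟩ := YBE.toTilde_surjective r a
      exact congrArg (fun s : Equiv.Perm (YBE.Tilde r) => s b) (hlam x)
    · intro a b
      obtain ⟨x, rfl⟩ := YBE.toTilde_surjective r a
      obtain ⟨y, rfl⟩ := YBE.toTilde_surjective r b
      rw [YBE.sigma_injectivization, YBE.tau_injectivization]
      exact YBE.iota_mul_iota r x y
  refine ⟨h.isInvolutive_of_isTorsionFreeGroup hs hsnd, fun hi => ?_⟩
  obtain ⟨Φ, hΦ⟩ := YBE.exists_hom_of_map_mul (r := r)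
    (fun x => YBE.affineGen (hsnd.sigmaPerm (YBE.toTilde r x)) (YBE.toTilde r x)) (by
      intro x y
      rw [YBE.affineGen_mul_affineGen hs hsnd hi, YBE.sigma_injectivization,
        YBE.tau_injectivization])
  refine h.isTorsionFreeGroup_of_isInvolutive hs hsnd hi (Φ := Φ) fun a => ?_
  obtain ⟨x, rfl⟩ := YBE.toTilde_surjective r a
  exact (hΦ x).trans (congrArg (fun s => YBE.affineGen s (YBE.toTilde r x)) (hlam x).symm)
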